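/- For $x\in\mathbb{C}$ and an integer $k\ge 0$ let $(x)_k=x(x+1)\cdots(x+k-1)$ (so $(x)_0=1$, and $(x)_k=\Gamma(x+k)/\Gamma(x)$ when $x\notin\{0,-1,-2,\dots\}$), and let $${}_3F_2\!\left[\begin{matrix}a_0,a_1,a_2\\ b_1,b_2\end{matrix};1\right]=\sum_{k=0}^{\infty}\frac{(a_0)_k(a_1)_k(a_2)_k}{k!\,(b_1)_k(b_2)_k}.$$ **Nonterminating Saalschütz formula.** Let $a,b,c,d\in\mathbb{C}$ satisfy $\operatorname{Re}(d-a-b)>0$, and suppose that none of $c,\ d,\ c-a-b,\ c+d-a-b$ is in $\{0,-1,-2,\dots\}$. Then both series below converge absolutely, and $${}_3F_2\!\left[\begin{matrix}a,\,b,\,c+d-a-b-1\\ c,\,d\end{matrix};1\right] ={}_3F_2\!\left[\begin{matrix}1,\,c-a,\,c-b\\ c-a-b+1,\,c+d-a-b\end{matrix};1\right]\cdot\frac{\Gamma(c)\Gamma(d)}{\Gamma(a)\Gamma(b)\Gamma(c+d-a-b)}\cdot\frac{1}{a+b-c} +\frac{\Gamma(c)\Gamma(d)\Gamma(c-a-b)\Gamma(d-a-b)}{\Gamma(c-a)\Gamma(c-b)\Gamma(d-a)\Gamma(d-b)},$$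 where $1/\Gamma(x)$ is read as $0$ for $x\in\{0,-1,-2,\dots\}$. -/

import Mathlib

/-- The shifted factorial `(x)_k = x (x + 1) ⋯ (x + k - 1)`, which is `Γ(x + k) / Γ(x)` whenever
`x` is not a pole of `Γ`. -/
noncomputable def shiftedFactorial (x : ℂ) (k : ℕ) : ℂ :=
  (ascPochhammer ℂ k).eval x

/-- The `k`-th term `(a₀)_k ⋯ (a_r)_k / (k! (b₁)_k ⋯ (b_s)_k) z ^ k` of the hypergeometric series
with numerator parameters `as` and denominator parameters `bs`. -/
noncomputable def hypergeometricTerm (as bs : List ℂ) (z : ℂ) (k : ℕ) : ℂ :=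
  (as.map fun a => shiftedFactorial a k).prod /
    ((Nat.factorial k : ℂ) * (bs.map fun b => shiftedFactorial b k).prod) * z ^ k

/-- The hypergeometric series with numerator parameters `as` and denominator parameters `bs`,
evaluated at `z`. -/
noncomputable def hypergeometricPFQ (as bs : List ℂ) (z : ℂ) : ℂ :=
  ∑' k : ℕ, hypergeometricTerm as bs z k

/-!
Write `δ = d - a - b - 1` and let `S c` be the balanced series
`∑ (a)_k (b)_k (c + δ)_k / (k! (c)_k (d)_k)`. The proof is a telescoping in the parameter `c`, with
`a`, `b`, `δ`, `d` fixed. The terms of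
`S c - (c - a) (c - b) / (c (c - a - b)) * S (c + 1)` are first differences of a hypergeometric
sequence in `k` (`sum_saalschutz_contiguous`). Because the series is balanced, that sequence has a
finite, generally nonzero, limit as `k → ∞`, which Euler's limit formula for `Γ` evaluates. Hence
`S c = (c - a) (c - b) / (c (c - a - b)) * S (c + 1) + β c` with an explicit quotient of Gamma
functions `β c` (`tsum_saalschutz_contiguous`).

Iterating this `N` times and letting `N → ∞`, the accumulated boundary terms `β (c + n)` become the
second `₃F₂` series. The product of the factors in front of `S (c + N)` tends to a quotient of
Gamma functions (`tendsto_shiftedFactorial_balanced`), while `S (c + N)` tends to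
`₂F₁(a, b; d; 1)` by dominated convergence (`tendsto_tsum_saalschutz_add`); the domination is
`exists_norm_shiftedFactorial_div_le`. Gauss's formula for `₂F₁(a, b; d; 1)` (`tsum_gauss`) is
proved by the same telescoping in `d`, where the boundary value vanishes.

The summations use `(1)_k` in place of `k!`, so that every term is a quotient of shifted factorials.
-/

open Filter Topology Asymptotics

/-! ### Shifted factorials -/

theorem shiftedFactorial_zero (x : ℂ) : shiftedFactorial x 0 = 1 := by
  simp [shiftedFactorial]

theorem shiftedFactorial_succ (x : ℂ) (k : ℕ) :
    shiftedFactorial x (k + 1) = shiftedFactorial x k * (x + k) :=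
  ascPochhammer_succ_eval k x

theorem shiftedFactorial_eq_prod (x : ℂ) (k : ℕ) :
    shiftedFactorial x k = ∏ j ∈ Finset.range k, (x + j) := by
  induction k with
  | zero => simp [shiftedFactorial_zero]
  | succ k ih => rw [shiftedFactorial_succ, Finset.prod_range_succ, ih]

theorem shiftedFactorial_succ_left (x : ℂ) (k : ℕ) :
    shiftedFactorial x (k + 1) = x * shiftedFactorial (x + 1) k := by
  rw [shiftedFactorial_eq_prod, shiftedFactorial_eq_prod, Finset.prod_range_succ', mul_comm]
  push_cast
  simp only [add_zero]
  congr 1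
  exact Finset.prod_congr rfl fun j _ => by ring

theorem shiftedFactorial_one (k : ℕ) : shiftedFactorial 1 k = (k.factorial : ℂ) := by
  simp [shiftedFactorial, ascPochhammer_eval_one]

theorem add_natCast_ne_zero {x : ℂ} (hx : ∀ n : ℕ, x ≠ -(n : ℂ)) (k : ℕ) : x + k ≠ 0 :=
  fun h => hx k (eq_neg_of_add_eq_zero_left h)

theorem add_natCast_ne_neg {x : ℂ} (hx : ∀ n : ℕ, x ≠ -(n : ℂ)) (m n : ℕ) :
    x + m ≠ -(n : ℂ) := by
  intro h
  apply hx (m + n)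
  push_cast
  linear_combination h

theorem one_ne_neg_natCast (n : ℕ) : (1 : ℂ) ≠ -(n : ℂ) := by
  intro h
  have : ((1 + n : ℕ) : ℂ) = 0 := by push_cast; linear_combination h
  exact absurd (Nat.cast_eq_zero.mp this) (by omega)

theorem shiftedFactorial_add_one_eq {x : ℂ} (hx : x ≠ 0) (k : ℕ) :
    shiftedFactorial (x + 1) k = shiftedFactorial x k * (x + k) / x := by
  rw [← shiftedFactorial_succ, shiftedFactorial_succ_left, mul_div_cancel_left₀ _ hx]

theorem ne_zero_of_ne_neg_natCast {x : ℂ} (hx : ∀ n : ℕ, x ≠ -(n : ℂ)) : x ≠ 0 := by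
  simpa using hx 0

theorem ne_neg_natCast_of_re_pos {x : ℂ} (hx : 0 < x.re) (n : ℕ) : x ≠ -(n : ℂ) := by
  rintro rfl
  have : (0 : ℝ) ≤ n := Nat.cast_nonneg n
  simp at hx
  linarith

theorem shiftedFactorial_ne_zero {x : ℂ} (hx : ∀ n : ℕ, x ≠ -(n : ℂ)) (k : ℕ) :
    shiftedFactorial x k ≠ 0 := by
  rw [shiftedFactorial_eq_prod]
  exact Finset.prod_ne_zero_iff.mpr fun j _ => add_natCast_ne_zero hx j

theorem Gamma_add_natCast {x : ℂ} (hx : ∀ n : ℕ, x ≠ -(n : ℂ)) (k : ℕ) :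
    Complex.Gamma (x + k) = shiftedFactorial x k * Complex.Gamma x := by
  induction k with
  | zero => simp [shiftedFactorial_zero]
  | succ k ih =>
    rw [Nat.cast_succ, ← add_assoc, Complex.Gamma_add_one _ (add_natCast_ne_zero hx k), ih,
      shiftedFactorial_succ]
    ring

/-! ### Asymptotics of shifted factorials -/

/-- Euler's limit formula for `1 / Γ`. It holds at the poles of `Γ` too, where both sides are `0`
because Mathlib's `Γ` vanishes there. -/
theorem tendsto_shiftedFactorial_div (s : ℂ) :
    Tendsto (fun n : ℕ => shiftedFactorial s (n + 1) / ((n : ℂ) ^ s * (n.factorial : ℂ))) atTop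
      (𝓝 (Complex.Gamma s)⁻¹) := by
  by_cases hs : ∀ m : ℕ, s ≠ -(m : ℂ)
  · refine ((Complex.GammaSeq_tendsto_Gamma s).inv₀ (Complex.Gamma_ne_zero hs)).congr fun n => ?_
    rw [Complex.GammaSeq, inv_div, shiftedFactorial_eq_prod]
  · push Not at hs
    obtain ⟨m, rfl⟩ := hs
    rw [Complex.Gamma_neg_nat_eq_zero, inv_zero]
    refine tendsto_const_nhds.congr' ?_
    filter_upwards [eventually_ge_atTop m] with n hn
    rw [shiftedFactorial_eq_prod,
      Finset.prod_eq_zero (Finset.mem_range.mpr (Nat.lt_succ_of_le hn)) (by simp), zero_div]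

/-- The quotient grows like `n` to the power (sum of numerator parameters) minus (sum of denominator
parameters). Only the denominator parameters have to avoid the poles of `Γ`. -/
theorem tendsto_shiftedFactorial_ratio (A B E : ℂ) {C D F : ℂ}
    (hC : ∀ n : ℕ, C ≠ -(n : ℂ)) (hD : ∀ n : ℕ, D ≠ -(n : ℂ)) (hF : ∀ n : ℕ, F ≠ -(n : ℂ)) :
    Tendsto (fun n : ℕ =>
      shiftedFactorial A (n + 1) * shiftedFactorial B (n + 1) * shiftedFactorial E (n + 1) /
        (shiftedFactorial C (n + 1) * shiftedFactorial D (n + 1) * shiftedFactorial F (n + 1)) /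
          (n : ℂ) ^ (A + B + E - C - D - F)) atTop
      (𝓝 (Complex.Gamma C * Complex.Gamma D * Complex.Gamma F /
        (Complex.Gamma A * Complex.Gamma B * Complex.Gamma E))) := by
  have hne : (Complex.Gamma C)⁻¹ * (Complex.Gamma D)⁻¹ * (Complex.Gamma F)⁻¹ ≠ 0 := by
    simp [Complex.Gamma_ne_zero hC, Complex.Gamma_ne_zero hD, Complex.Gamma_ne_zero hF]
  have key := (((tendsto_shiftedFactorial_div A).mul (tendsto_shiftedFactorial_div B)).mul
    (tendsto_shiftedFactorial_div E)).div (((tendsto_shiftedFactorial_div C).mul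
    (tendsto_shiftedFactorial_div D)).mul (tendsto_shiftedFactorial_div F)) hne
  have hlim : (Complex.Gamma A)⁻¹ * (Complex.Gamma B)⁻¹ * (Complex.Gamma E)⁻¹ /
      ((Complex.Gamma C)⁻¹ * (Complex.Gamma D)⁻¹ * (Complex.Gamma F)⁻¹) =
      Complex.Gamma C * Complex.Gamma D * Complex.Gamma F /
        (Complex.Gamma A * Complex.Gamma B * Complex.Gamma E) := by
    rw [← mul_inv, ← mul_inv, ← mul_inv, ← mul_inv, inv_div_inv]
  rw [hlim] at key
  refine key.congr' ?_
  filter_upwards [eventually_ne_atTop 0] with n hn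
  have hn' : (n : ℂ) ≠ 0 := Nat.cast_ne_zero.mpr hn
  have hf : (n.factorial : ℂ) ≠ 0 := Nat.cast_ne_zero.mpr n.factorial_ne_zero
  have h1 := shiftedFactorial_ne_zero hC (n + 1)
  have h2 := shiftedFactorial_ne_zero hD (n + 1)
  have h3 := shiftedFactorial_ne_zero hF (n + 1)
  have hp : ∀ z : ℂ, (n : ℂ) ^ z ≠ 0 := fun z => by simp [Complex.cpow_eq_zero_iff, hn']
  simp only [Pi.div_apply]
  rw [Complex.cpow_sub _ _ hn', Complex.cpow_sub _ _ hn', Complex.cpow_sub _ _ hn',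
    Complex.cpow_add _ _ hn', Complex.cpow_add _ _ hn']
  have := hp A; have := hp B; have := hp C; have := hp D; have := hp E; have := hp F
  field_simp

theorem summable_shiftedFactorial_ratio {A B E C D F : ℂ}
    (hC : ∀ n : ℕ, C ≠ -(n : ℂ)) (hD : ∀ n : ℕ, D ≠ -(n : ℂ)) (hF : ∀ n : ℕ, F ≠ -(n : ℂ))
    (h : (A + B + E - C - D - F).re < -1) :
    Summable fun k : ℕ =>
      shiftedFactorial A k * shiftedFactorial B k * shiftedFactorial E k /
        (shiftedFactorial C k * shiftedFactorial D k * shiftedFactorial F k) := by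
  rw [← summable_nat_add_iff 1]
  refine summable_of_isBigO_nat (Real.summable_nat_rpow.mpr h) ?_
  have h1 := (tendsto_shiftedFactorial_ratio A B E hC hD hF).isBigO_one ℝ
  have h2 : (fun n : ℕ => (n : ℂ) ^ (A + B + E - C - D - F)) =O[atTop]
      fun n : ℕ => (n : ℝ) ^ (A + B + E - C - D - F).re := by
    refine IsBigO.of_bound 1 ?_
    filter_upwards [eventually_gt_atTop 0] with n hn
    rw [Complex.norm_natCast_cpow_of_pos hn, one_mul]
    exact le_abs_self _
  refine (h1.mul h2).congr' ?_ (by simp)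
  filter_upwards [eventually_ne_atTop 0] with n hn
  have hn' : (n : ℂ) ≠ 0 := Nat.cast_ne_zero.mpr hn
  exact div_mul_cancel₀ _ (by simp [Complex.cpow_eq_zero_iff, hn'])

theorem tendsto_shiftedFactorial_balanced (A B : ℂ) {C D : ℂ}
    (hC : ∀ n : ℕ, C ≠ -(n : ℂ)) (hD : ∀ n : ℕ, D ≠ -(n : ℂ)) (h : A + B = C + D) :
    Tendsto (fun n : ℕ => shiftedFactorial A n * shiftedFactorial B n /
        (shiftedFactorial C n * shiftedFactorial D n)) atTop
      (𝓝 (Complex.Gamma C * Complex.Gamma D / (Complex.Gamma A * Complex.Gamma B))) := by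
  rw [← tendsto_add_atTop_iff_nat 1]
  have key := tendsto_shiftedFactorial_ratio A B 1 hC hD one_ne_neg_natCast
  have hexp : A + B + 1 - C - D - 1 = 0 := by linear_combination h
  simp only [hexp, Complex.cpow_zero, div_one, Complex.Gamma_one, mul_one] at key
  refine key.congr fun n => ?_
  exact mul_div_mul_right _ _ (shiftedFactorial_ne_zero one_ne_neg_natCast _)

theorem tendsto_add_natCast_div (z w : ℂ) :
    Tendsto (fun n : ℕ => (z + n) / (w + n)) atTop (𝓝 1) := by
  have h := (tendsto_natCast_div_add_atTop (𝕜 := ℂ) w).div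
    (tendsto_natCast_div_add_atTop (𝕜 := ℂ) z) one_ne_zero
  rw [div_one] at h
  refine h.congr' ?_
  filter_upwards [eventually_ne_atTop 0] with n hn
  have hn' : (n : ℂ) ≠ 0 := Nat.cast_ne_zero.mpr hn
  simp only [Pi.div_apply]
  rw [div_div_div_cancel_left' _ _ hn', add_comm, add_comm w]

theorem tendsto_shiftedFactorial_add_div (z w : ℂ) (k : ℕ) :
    Tendsto (fun n : ℕ => shiftedFactorial (z + n) k / shiftedFactorial (w + n) k) atTop
      (𝓝 1) := by
  induction k with
  | zero => simp [shiftedFactorial_zero]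
  | succ k ih =>
    have h := ih.mul (tendsto_add_natCast_div (z + k) (w + k))
    rw [mul_one] at h
    refine h.congr fun n => ?_
    rw [shiftedFactorial_succ, shiftedFactorial_succ, div_mul_div_comm]
    congr 2 <;> ring

/-! ### A uniform bound for quotients of shifted factorials -/

/-- To first order in `1 / x` the bound depends on `z`, `w` through the difference of their real parts
only; the imaginary part contributes at second order, which is what makes products of these bounds
along `z + j`, `w + j` comparable to `∏ (1 + σ / (1 + j))`. -/
theorem norm_div_le_of_re {z w : ℂ} {x σ : ℝ} (hx : 0 < x) (hσ : 0 ≤ σ) (hz : x ≤ z.re)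
    (hw : x ≤ w.re) (h : z.re - w.re ≤ σ) :
    ‖z‖ / ‖w‖ ≤ (1 + σ / x) * (1 + z.im ^ 2 / x ^ 2) := by
  have hz0 : 0 < z.re := hx.trans_le hz
  have hw0 : 0 < w.re := hx.trans_le hw
  have hwn : w.re ≤ ‖w‖ := Complex.re_le_norm w
  have hzn : ‖z‖ ≤ z.re + z.im ^ 2 / z.re := by
    rw [Complex.norm_eq_sqrt_sq_add_sq]
    refine Real.sqrt_le_iff.mpr ⟨by positivity, ?_⟩
    have : (z.re + z.im ^ 2 / z.re) ^ 2 = z.re ^ 2 + 2 * z.im ^ 2 + (z.im ^ 2 / z.re) ^ 2 := by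
      field_simp
      ring
    rw [this]
    nlinarith [sq_nonneg z.im, sq_nonneg (z.im ^ 2 / z.re)]
  calc ‖z‖ / ‖w‖ ≤ (z.re + z.im ^ 2 / z.re) / w.re := by gcongr
    _ = z.re / w.re + z.im ^ 2 / (z.re * w.re) := by field_simp
    _ ≤ (1 + σ / x) + z.im ^ 2 / x ^ 2 := by
        gcongr ?_ + ?_
        · calc z.re / w.re ≤ (w.re + σ) / w.re := by gcongr; linarith
            _ = 1 + σ / w.re := by field_simp
            _ ≤ 1 + σ / x := by gcongr
        · rw [sq x]; gcongr
    _ ≤ (1 + σ / x) * (1 + z.im ^ 2 / x ^ 2) := by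
        have : 0 ≤ σ / x * (z.im ^ 2 / x ^ 2) := by positivity
        nlinarith

/-- A bound for quotients of shifted factorials that depends on `z` and `w` only through `Im z` and
an upper bound `σ` for `Re (z - w)`, hence is uniform along `z + n`, `w + n`. -/
theorem exists_norm_shiftedFactorial_div_le (y : ℝ) {σ : ℝ} (hσ : 0 ≤ σ) :
    ∃ M : ℝ, ∀ z w : ℂ, z.im = y → 1 ≤ z.re → 1 ≤ w.re → z.re - w.re ≤ σ → ∀ k : ℕ,
      ‖shiftedFactorial z k / shiftedFactorial w k‖ ≤
        M * ‖shiftedFactorial (1 + σ) k / shiftedFactorial 1 k‖ := by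
  have hsum : Summable fun j : ℕ => y ^ 2 / ((j : ℝ) + 1) ^ 2 := by
    have := (summable_nat_add_iff 1).mpr (Real.summable_one_div_nat_pow.mpr one_lt_two)
    simpa [div_eq_mul_inv] using this.mul_left (y ^ 2)
  refine ⟨Real.exp (∑' j : ℕ, y ^ 2 / ((j : ℝ) + 1) ^ 2), ?_⟩
  intro z w hy hz hw h k
  have hfac : ∀ j ∈ Finset.range k, ‖z + j‖ / ‖w + j‖ ≤
      (1 + y ^ 2 / ((j : ℝ) + 1) ^ 2) * (‖(1 + σ : ℂ) + j‖ / ‖(1 : ℂ) + j‖) := by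
    intro j _
    have h1 := norm_div_le_of_re (z := z + j) (w := w + j) (x := (j : ℝ) + 1) (σ := σ)
      (by positivity) hσ (by simp; linarith) (by simp; linarith) (by simpa using h)
    have e1 : ‖(1 + σ : ℂ) + j‖ = 1 + σ + j := by
      rw [show (1 + σ : ℂ) + j = ((1 + σ + j : ℝ) : ℂ) by push_cast; ring, Complex.norm_real,
        Real.norm_of_nonneg (by positivity)]
    have e2 : ‖(1 : ℂ) + j‖ = 1 + j := by
      rw [show (1 : ℂ) + j = ((1 + j : ℝ) : ℂ) by push_cast; ring, Complex.norm_real,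
        Real.norm_of_nonneg (by positivity)]
    rw [e1, e2]
    have e3 : (1 + σ + j) / (1 + j) = 1 + σ / ((j : ℝ) + 1) := by
      have : (1 + (j : ℝ)) ≠ 0 := by positivity
      have : ((j : ℝ) + 1) ≠ 0 := by positivity
      field_simp
      ring
    rw [e3, mul_comm]
    simpa [hy] using h1
  have hprod : ∏ j ∈ Finset.range k, (1 + y ^ 2 / ((j : ℝ) + 1) ^ 2) ≤
      Real.exp (∑' j : ℕ, y ^ 2 / ((j : ℝ) + 1) ^ 2) :=
    (Real.prod_one_add_le_exp_sum _ fun _ => by positivity).trans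
      (Real.exp_le_exp.mpr (hsum.sum_le_tsum _ fun _ _ => by positivity))
  simp only [shiftedFactorial_eq_prod, norm_div, norm_prod, ← Finset.prod_div_distrib]
  calc _ ≤ ∏ j ∈ Finset.range k,
        (1 + y ^ 2 / ((j : ℝ) + 1) ^ 2) * (‖(1 + σ : ℂ) + j‖ / ‖(1 : ℂ) + j‖) :=
        Finset.prod_le_prod (fun _ _ => by positivity) hfac
    _ ≤ _ := by
        rw [Finset.prod_mul_distrib]
        gcongr

/-! ### Iterating a contiguous relation -/

theorem eq_prod_mul_add_sum_of_recurrence {R : Type*} [CommRing R] {S ρ β : ℕ → R}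
    (h : ∀ n, S n = ρ n * S (n + 1) + β n) (N : ℕ) :
    S 0 = (∏ j ∈ Finset.range N, ρ j) * S N +
      ∑ n ∈ Finset.range N, (∏ j ∈ Finset.range n, ρ j) * β n := by
  induction N with
  | zero => simp
  | succ N ih =>
    rw [ih, Finset.prod_range_succ, Finset.sum_range_succ, h N]
    ring

/-- The product of the factors `(x - a) (x - b) / (x (x - a - b))` of the contiguous relations along
`x, x + 1, …`. -/
theorem prod_contiguity_factor (x a b : ℂ) (n : ℕ) :
    ∏ j ∈ Finset.range n, ((x + j - a) * (x + j - b) / ((x + j) * (x + j - a - b))) =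
      shiftedFactorial (x - a) n * shiftedFactorial (x - b) n /
        (shiftedFactorial x n * shiftedFactorial (x - a - b) n) := by
  simp only [shiftedFactorial_eq_prod, ← Finset.prod_mul_distrib, ← Finset.prod_div_distrib]
  refine Finset.prod_congr rfl fun j _ => ?_
  congr 2 <;> ring

/-- Asymptotics of the sequence whose first differences appear in the two contiguous relations. -/
theorem tendsto_shiftedFactorial_certificate (A B : ℂ) {E C D : ℂ}
    (hE : ∀ n : ℕ, E ≠ -(n : ℂ)) (hC : ∀ n : ℕ, C ≠ -(n : ℂ)) (hD : ∀ n : ℕ, D ≠ -(n : ℂ)) :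
    Tendsto (fun n : ℕ =>
      shiftedFactorial A (n + 1) * shiftedFactorial B (n + 1) * shiftedFactorial E n /
        (shiftedFactorial 1 n * shiftedFactorial C (n + 1) * shiftedFactorial D n) /
          (n : ℂ) ^ (A + B + E - C - D)) atTop
      (𝓝 (Complex.Gamma C * Complex.Gamma D /
        (Complex.Gamma A * Complex.Gamma B * Complex.Gamma E))) := by
  have h := ((tendsto_shiftedFactorial_ratio A B E hC hD one_ne_neg_natCast).mul
    (tendsto_add_natCast_div D E)).mul (tendsto_add_natCast_div 1 0)
  rw [Complex.Gamma_one, mul_one, mul_one, mul_one] at h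
  refine h.congr' ?_
  filter_upwards [eventually_ne_atTop 0] with n hn
  have hn' : (n : ℂ) ≠ 0 := Nat.cast_ne_zero.mpr hn
  have hexp : A + B + E - C - D = (A + B + E - C - D - 1) + 1 := by ring
  have hp : (n : ℂ) ^ (A + B + E - C - D - 1) ≠ 0 := by simp [Complex.cpow_eq_zero_iff, hn']
  rw [hexp, Complex.cpow_add _ _ hn', Complex.cpow_one, add_sub_cancel_right,
    shiftedFactorial_succ E, shiftedFactorial_succ D, shiftedFactorial_succ 1]
  have := shiftedFactorial_ne_zero hC (n + 1)
  have := shiftedFactorial_ne_zero hD n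
  have := shiftedFactorial_ne_zero one_ne_neg_natCast n
  have := add_natCast_ne_zero hE n
  have := add_natCast_ne_zero hD n
  have := add_natCast_ne_zero one_ne_neg_natCast n
  rw [zero_add]
  field_simp

/-! ### Gauss's summation formula -/

/-- The telescoping identity behind Gauss's formula: two series whose parameters `d` and `d + 1`
are contiguous differ, termwise and up to a constant factor, by a first difference. -/
theorem sum_gauss_contiguous (a b : ℂ) {d : ℂ} (hd : ∀ n : ℕ, d ≠ -(n : ℂ))
    (hdab : d - a - b ≠ 0) (K : ℕ) :
    ∑ k ∈ Finset.range (K + 1),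
      (shiftedFactorial a k * shiftedFactorial b k /
          (shiftedFactorial 1 k * shiftedFactorial d k) -
        (d - a) * (d - b) / (d * (d - a - b)) *
          (shiftedFactorial a k * shiftedFactorial b k /
            (shiftedFactorial 1 k * shiftedFactorial (d + 1) k))) =
      -1 / (d - a - b) * (shiftedFactorial a (K + 1) * shiftedFactorial b (K + 1) /
        (shiftedFactorial 1 K * shiftedFactorial d (K + 1))) := by
  have hd0 := ne_zero_of_ne_neg_natCast hd
  induction K with
  | zero =>
    simp only [zero_add, Finset.sum_range_one, shiftedFactorial_zero, shiftedFactorial_succ,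
      Nat.cast_zero, add_zero, one_mul, mul_one]
    field_simp
    ring
  | succ K ih =>
    rw [Finset.sum_range_succ, ih, shiftedFactorial_add_one_eq hd0, shiftedFactorial_succ a (K + 1),
      shiftedFactorial_succ b (K + 1), shiftedFactorial_succ d (K + 1), shiftedFactorial_succ 1 K]
    have := shiftedFactorial_ne_zero hd (K + 1)
    have := shiftedFactorial_ne_zero one_ne_neg_natCast K
    have := add_natCast_ne_zero hd (K + 1)
    have h1 := add_natCast_ne_zero one_ne_neg_natCast K
    push_cast at *
    field_simp
    ring

theorem summable_gauss {a b d : ℂ} (hd : ∀ n : ℕ, d ≠ -(n : ℂ)) (hre : 0 < (d - a - b).re) :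
    Summable fun k : ℕ => shiftedFactorial a k * shiftedFactorial b k /
      (shiftedFactorial 1 k * shiftedFactorial d k) := by
  have h := summable_shiftedFactorial_ratio (A := a) (B := b) (E := 1) one_ne_neg_natCast hd
    one_ne_neg_natCast (by simp at hre ⊢; linarith)
  exact h.congr fun k => mul_div_mul_right _ _ (shiftedFactorial_ne_zero one_ne_neg_natCast k)

theorem tsum_gauss_contiguous {a b d : ℂ} (hd : ∀ n : ℕ, d ≠ -(n : ℂ))
    (hre : 0 < (d - a - b).re) :
    ∑' k : ℕ, shiftedFactorial a k * shiftedFactorial b k /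
        (shiftedFactorial 1 k * shiftedFactorial d k) =
      (d - a) * (d - b) / (d * (d - a - b)) *
        ∑' k : ℕ, shiftedFactorial a k * shiftedFactorial b k /
          (shiftedFactorial 1 k * shiftedFactorial (d + 1) k) := by
  have hd1 : ∀ n : ℕ, d + 1 ≠ -(n : ℂ) := by simpa using add_natCast_ne_neg hd 1
  have hs := summable_gauss hd hre
  have hs1 := summable_gauss (a := a) (b := b) hd1 (by simp at hre ⊢; linarith)
  have hlim := (hs.hasSum.sub (hs1.hasSum.mul_left
    ((d - a) * (d - b) / (d * (d - a - b))))).tendsto_sum_nat.comp (tendsto_add_atTop_nat 1)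
  have hzero : Tendsto (fun K : ℕ => -1 / (d - a - b) *
      (shiftedFactorial a (K + 1) * shiftedFactorial b (K + 1) /
        (shiftedFactorial 1 K * shiftedFactorial d (K + 1)))) atTop (𝓝 0) := by
    have hpow : Tendsto (fun n : ℕ => (n : ℂ) ^ (a + b + 1 - d - 1)) atTop (𝓝 0) := by
      rw [tendsto_zero_iff_norm_tendsto_zero]
      have := (tendsto_rpow_neg_atTop hre).comp (tendsto_natCast_atTop_atTop (R := ℝ))
      refine this.congr' ?_
      filter_upwards [eventually_gt_atTop 0] with n hn
      rw [Complex.norm_natCast_cpow_of_pos hn, Function.comp_apply]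
      congr 1
      simp
      ring
    have h := ((tendsto_shiftedFactorial_certificate a b one_ne_neg_natCast hd
      one_ne_neg_natCast).mul hpow).const_mul (-1 / (d - a - b))
    rw [mul_zero, mul_zero] at h
    refine h.congr' ?_
    filter_upwards [eventually_ne_atTop 0] with n hn
    have hn' : (n : ℂ) ≠ 0 := Nat.cast_ne_zero.mpr hn
    rw [div_mul_cancel₀ _ (by simp [Complex.cpow_eq_zero_iff, hn']),
      mul_div_mul_right _ _ (shiftedFactorial_ne_zero one_ne_neg_natCast n)]
  have hdab : d - a - b ≠ 0 := ne_zero_of_ne_neg_natCast (ne_neg_natCast_of_re_pos hre)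
  exact sub_eq_zero.mp (tendsto_nhds_unique hlim
    (hzero.congr fun K => (sum_gauss_contiguous a b hd hdab K).symm))

theorem tendsto_inv_shiftedFactorial_add (d : ℂ) (k : ℕ) :
    Tendsto (fun n : ℕ => (shiftedFactorial (d + n) k)⁻¹) atTop
      (𝓝 (if k = 0 then 1 else 0)) := by
  induction k with
  | zero => simp [shiftedFactorial_zero]
  | succ k ih =>
    have h : Tendsto (fun n : ℕ => ((d + k) + (n : ℂ))⁻¹) atTop (𝓝 0) :=
      tendsto_inv₀_cobounded.comp
        ((tendsto_const_add_cobounded (d + (k : ℂ))).comp tendsto_natCast_atTop_cobounded)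
    have h' := ih.mul h
    rw [mul_zero] at h'
    simp only [Nat.succ_ne_zero, if_false]
    refine h'.congr fun n => ?_
    rw [shiftedFactorial_succ, mul_inv]
    congr 2
    ring

theorem norm_shiftedFactorial_le_add {d : ℂ} (hd : 0 ≤ d.re) (n k : ℕ) :
    ‖shiftedFactorial d k‖ ≤ ‖shiftedFactorial (d + n) k‖ := by
  simp only [shiftedFactorial_eq_prod, norm_prod]
  refine Finset.prod_le_prod (fun _ _ => norm_nonneg _) fun j _ => ?_
  have hn : (0 : ℝ) ≤ n := Nat.cast_nonneg n
  have hj : (0 : ℝ) ≤ j := Nat.cast_nonneg j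
  rw [Complex.norm_eq_sqrt_sq_add_sq, Complex.norm_eq_sqrt_sq_add_sq]
  refine Real.sqrt_le_sqrt ?_
  simp
  nlinarith

/-- All terms but the zeroth tend to `0`; the tail of the sequence is dominated by any member whose
parameter `d + n` has positive real part. -/
theorem tendsto_tsum_gauss_add {a b d : ℂ} (hre : 0 < (d - a - b).re) :
    Tendsto (fun n : ℕ => ∑' k : ℕ, shiftedFactorial a k * shiftedFactorial b k /
      (shiftedFactorial 1 k * shiftedFactorial (d + n) k)) atTop (𝓝 1) := by
  obtain ⟨m, hm⟩ := exists_nat_gt (-d.re)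
  have hdm : 0 < (d + m).re := by simp; linarith
  have hs := (summable_gauss (a := a) (b := b) (ne_neg_natCast_of_re_pos hdm)
    (by
      have : (0 : ℝ) ≤ m := Nat.cast_nonneg m
      simp at hre ⊢
      linarith)).norm
  have hsingle : ∑' k : ℕ, shiftedFactorial a k * shiftedFactorial b k / shiftedFactorial 1 k *
      (if k = 0 then 1 else 0) = 1 := by
    rw [tsum_eq_single 0 (by intro k hk; simp [hk])]
    simp [shiftedFactorial_zero]
  refine (tendsto_tsum_of_dominated_convergence hs (fun k => ?_) ?_).trans
    (congrArg 𝓝 hsingle).le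
  · refine ((tendsto_inv_shiftedFactorial_add d k).const_mul _).congr fun n => ?_
    rw [← div_div, div_eq_mul_inv _ (shiftedFactorial (d + n) k)]
  · filter_upwards [eventually_ge_atTop m] with n hn k
    obtain ⟨l, rfl⟩ := Nat.exists_eq_add_of_le hn
    rw [norm_div, norm_div, norm_mul (shiftedFactorial 1 k), norm_mul (shiftedFactorial 1 k)]
    have h1 := norm_pos_iff.mpr (shiftedFactorial_ne_zero one_ne_neg_natCast k)
    have h2 := norm_pos_iff.mpr (shiftedFactorial_ne_zero (ne_neg_natCast_of_re_pos hdm) k)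
    have h3 := norm_shiftedFactorial_le_add hdm.le l k
    rw [add_assoc, ← Nat.cast_add] at h3
    gcongr

/-- Gauss's summation formula for `₂F₁(a, b; d; 1)`. -/
theorem tsum_gauss {a b d : ℂ} (hd : ∀ n : ℕ, d ≠ -(n : ℂ)) (hre : 0 < (d - a - b).re) :
    ∑' k : ℕ, shiftedFactorial a k * shiftedFactorial b k /
        (shiftedFactorial 1 k * shiftedFactorial d k) =
      Complex.Gamma d * Complex.Gamma (d - a - b) /
        (Complex.Gamma (d - a) * Complex.Gamma (d - b)) := by
  have hrec : ∀ n : ℕ, ∑' k : ℕ, shiftedFactorial a k * shiftedFactorial b k /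
      (shiftedFactorial 1 k * shiftedFactorial (d + n) k) =
      (d + n - a) * (d + n - b) / ((d + n) * (d + n - a - b)) *
        ∑' k : ℕ, shiftedFactorial a k * shiftedFactorial b k /
          (shiftedFactorial 1 k * shiftedFactorial (d + (n + 1 : ℕ)) k) + 0 := by
    intro n
    rw [tsum_gauss_contiguous (add_natCast_ne_neg hd n)
      (by
        have : (0 : ℝ) ≤ n := Nat.cast_nonneg n
        simp at hre ⊢
        linarith), add_zero]
    push_cast
    rw [add_assoc d]
  have hiter : ∀ N : ℕ, _ = _ := fun N => eq_prod_mul_add_sum_of_recurrence hrec N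
  simp only [mul_zero, Finset.sum_const_zero, add_zero, prod_contiguity_factor,
    Nat.cast_zero] at hiter
  have hlim := (tendsto_shiftedFactorial_balanced (d - a) (d - b) hd
    (ne_neg_natCast_of_re_pos hre) (by ring)).mul (tendsto_tsum_gauss_add hre)
  rw [mul_one] at hlim
  exact tendsto_nhds_unique (tendsto_const_nhds.congr hiter) hlim

/-! ### The contiguous relation for balanced series -/

/-- The telescoping identity for the balanced series: its termwise difference with the series in
which `c` is replaced by `c + 1`, suitably scaled, is a first difference. The balancing condition
is encoded in the third numerator parameter `c + d - a - b - 1`. -/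
theorem sum_saalschutz_contiguous (a b : ℂ) {c d : ℂ} (hc : ∀ n : ℕ, c ≠ -(n : ℂ))
    (hd : ∀ n : ℕ, d ≠ -(n : ℂ)) (hcab : c - a - b ≠ 0) (K : ℕ) :
    ∑ k ∈ Finset.range (K + 1),
      (shiftedFactorial a k * shiftedFactorial b k * shiftedFactorial (c + d - a - b - 1) k /
          (shiftedFactorial 1 k * shiftedFactorial c k * shiftedFactorial d k) -
        (c - a) * (c - b) / (c * (c - a - b)) *
          (shiftedFactorial a k * shiftedFactorial b k * shiftedFactorial (c + d - a - b) k /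
            (shiftedFactorial 1 k * shiftedFactorial (c + 1) k * shiftedFactorial d k))) =
      -1 / (c - a - b) *
        (shiftedFactorial a (K + 1) * shiftedFactorial b (K + 1) *
            shiftedFactorial (c + d - a - b) K /
          (shiftedFactorial 1 K * shiftedFactorial c (K + 1) * shiftedFactorial d K)) := by
  have hc0 := ne_zero_of_ne_neg_natCast hc
  induction K with
  | zero =>
    simp only [zero_add, Finset.sum_range_one, shiftedFactorial_zero, shiftedFactorial_succ,
      Nat.cast_zero, add_zero, one_mul, mul_one]
    field_simp
    ring
  | succ K ih =>
    rw [Finset.sum_range_succ, ih, shiftedFactorial_add_one_eq hc0, shiftedFactorial_succ a (K + 1),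
      shiftedFactorial_succ b (K + 1), shiftedFactorial_succ c (K + 1), shiftedFactorial_succ 1 K,
      shiftedFactorial_succ d K, shiftedFactorial_succ_left (c + d - a - b - 1) K, sub_add_cancel,
      shiftedFactorial_succ (c + d - a - b) K]
    have := shiftedFactorial_ne_zero hc (K + 1)
    have := shiftedFactorial_ne_zero hd K
    have := shiftedFactorial_ne_zero one_ne_neg_natCast K
    have := add_natCast_ne_zero hc (K + 1)
    have := add_natCast_ne_zero hd K
    have h1 := add_natCast_ne_zero one_ne_neg_natCast K
    push_cast at *
    field_simp
    ring

theorem summable_saalschutz (a b : ℂ) {c d : ℂ} (hc : ∀ n : ℕ, c ≠ -(n : ℂ))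
    (hd : ∀ n : ℕ, d ≠ -(n : ℂ)) :
    Summable fun k : ℕ =>
      shiftedFactorial a k * shiftedFactorial b k * shiftedFactorial (c + d - a - b - 1) k /
        (shiftedFactorial 1 k * shiftedFactorial c k * shiftedFactorial d k) :=
  summable_shiftedFactorial_ratio one_ne_neg_natCast hc hd (by simp; linarith)

/-- Since the series is balanced, the first difference of `sum_saalschutz_contiguous` does not sum
to `0`: its boundary value at infinity is the last summand here. -/
theorem tsum_saalschutz_contiguous (a b : ℂ) {c d : ℂ} (hc : ∀ n : ℕ, c ≠ -(n : ℂ))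
    (hd : ∀ n : ℕ, d ≠ -(n : ℂ)) (hcab : c - a - b ≠ 0)
    (hcdab : ∀ n : ℕ, c + d - a - b ≠ -(n : ℂ)) :
    ∑' k : ℕ, shiftedFactorial a k * shiftedFactorial b k *
        shiftedFactorial (c + d - a - b - 1) k /
          (shiftedFactorial 1 k * shiftedFactorial c k * shiftedFactorial d k) =
      (c - a) * (c - b) / (c * (c - a - b)) *
        ∑' k : ℕ, shiftedFactorial a k * shiftedFactorial b k *
          shiftedFactorial (c + 1 + d - a - b - 1) k /
            (shiftedFactorial 1 k * shiftedFactorial (c + 1) k * shiftedFactorial d k) +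
      -1 / (c - a - b) * (Complex.Gamma c * Complex.Gamma d /
        (Complex.Gamma a * Complex.Gamma b * Complex.Gamma (c + d - a - b))) := by
  have hc1 : ∀ n : ℕ, c + 1 ≠ -(n : ℂ) := by simpa using add_natCast_ne_neg hc 1
  have hlim := ((summable_saalschutz a b hc hd).hasSum.sub
    ((summable_saalschutz a b hc1 hd).hasSum.mul_left
      ((c - a) * (c - b) / (c * (c - a - b))))).tendsto_sum_nat.comp (tendsto_add_atTop_nat 1)
  have hcert := (tendsto_shiftedFactorial_certificate a b hcdab hc hd).const_mul
    (-1 / (c - a - b))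
  have hexp : a + b + (c + d - a - b) - c - d = 0 := by ring
  simp only [hexp, Complex.cpow_zero, div_one] at hcert
  have heq := tendsto_nhds_unique hlim (hcert.congr fun K => by
    rw [← sum_saalschutz_contiguous a b hc hd hcab K, Function.comp_apply]
    simp only [show c + 1 + d - a - b - 1 = c + d - a - b by ring])
  exact sub_eq_iff_eq_add'.mp heq

/-! ### The limit along `c + n` -/

/-- As `c + n → ∞`, the two parameters that contain `c` cancel, leaving `₂F₁(a, b; d; 1)`. -/
theorem tendsto_tsum_saalschutz_add {a b c d : ℂ} (hd : ∀ n : ℕ, d ≠ -(n : ℂ))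
    (hre : 0 < (d - a - b).re) :
    Tendsto (fun n : ℕ => ∑' k : ℕ, shiftedFactorial a k * shiftedFactorial b k *
      shiftedFactorial (c + n + d - a - b - 1) k /
        (shiftedFactorial 1 k * shiftedFactorial (c + n) k * shiftedFactorial d k)) atTop
      (𝓝 (∑' k : ℕ, shiftedFactorial a k * shiftedFactorial b k /
        (shiftedFactorial 1 k * shiftedFactorial d k))) := by
  have hsplit : ∀ (n k : ℕ), shiftedFactorial a k * shiftedFactorial b k *
      shiftedFactorial (c + n + d - a - b - 1) k /
        (shiftedFactorial 1 k * shiftedFactorial (c + n) k * shiftedFactorial d k) =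
      shiftedFactorial a k * shiftedFactorial b k /
        (shiftedFactorial 1 k * shiftedFactorial d k) *
      (shiftedFactorial ((c + d - a - b - 1) + n) k / shiftedFactorial (c + n) k) := by
    intro n k
    rw [div_mul_div_comm, show c + n + d - a - b - 1 = (c + d - a - b - 1) + n by ring]
    congr 1
    ring
  simp only [hsplit]
  -- The terms of `₂F₁(a, b; d; 1)` decay like `k ^ (-1 - Re (d - a - b))`, so a growth of order
  -- `k ^ σ` is affordable for the quotient as long as `σ < Re (d - a - b)`.
  set σ : ℝ := max (d - a - b - 1).re 0
  have hσ0 : 0 ≤ σ := le_max_right _ _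
  have hσ1 : σ < (d - a - b).re := by
    refine max_lt ?_ hre
    simp
  obtain ⟨M, hM⟩ := exists_norm_shiftedFactorial_div_le (c + d - a - b - 1).im hσ0
  have hs : Summable fun k : ℕ => M * ‖shiftedFactorial a k * shiftedFactorial b k *
      shiftedFactorial (1 + σ) k /
        (shiftedFactorial 1 k * shiftedFactorial 1 k * shiftedFactorial d k)‖ := by
    refine Summable.mul_left M (summable_shiftedFactorial_ratio one_ne_neg_natCast
      one_ne_neg_natCast hd ?_).norm
    simp at hσ1 ⊢
    linarith
  refine tendsto_tsum_of_dominated_convergence hs (fun k => ?_) ?_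
  · have h := (tendsto_shiftedFactorial_add_div (c + d - a - b - 1) c k).const_mul
      (shiftedFactorial a k * shiftedFactorial b k /
        (shiftedFactorial 1 k * shiftedFactorial d k))
    rwa [mul_one] at h
  · obtain ⟨m, hm⟩ := exists_nat_ge (max (1 - c.re) (1 - (c + d - a - b - 1).re))
    filter_upwards [eventually_ge_atTop m] with n hn k
    have hn' : (m : ℝ) ≤ n := Nat.cast_le.mpr hn
    have h1 := (le_max_left _ _).trans hm
    have h2 := (le_max_right _ _).trans hm
    have h3 : (d - a - b - 1).re ≤ σ := le_max_left _ _
    have h := hM ((c + d - a - b - 1) + n) (c + n) (by simp)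
      (by rw [Complex.add_re, Complex.natCast_re]; linarith)
      (by rw [Complex.add_re, Complex.natCast_re]; linarith)
      (by simp at h3 ⊢; linarith) k
    rw [norm_mul]
    calc _ ≤ ‖shiftedFactorial a k * shiftedFactorial b k /
          (shiftedFactorial 1 k * shiftedFactorial d k)‖ *
          (M * ‖shiftedFactorial (1 + σ) k / shiftedFactorial 1 k‖) := by gcongr
      _ = _ := by
        rw [mul_left_comm, ← norm_mul, div_mul_div_comm]
        congr 3
        ring

/-! ### The nonterminating Saalschütz formula -/

theorem mainTheorem2 (a b c d : ℂ)
    (hre : 0 < (d - a - b).re)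
    (hc : ∀ n : ℕ, c ≠ -(n : ℂ))
    (hd : ∀ n : ℕ, d ≠ -(n : ℂ))
    (hcab : ∀ n : ℕ, c - a - b ≠ -(n : ℂ))
    (hcdab : ∀ n : ℕ, c + d - a - b ≠ -(n : ℂ)) :
    Summable (fun k : ℕ => hypergeometricTerm [a, b, c + d - a - b - 1] [c, d] 1 k) ∧
    Summable (fun k : ℕ =>
      hypergeometricTerm [1, c - a, c - b] [c - a - b + 1, c + d - a - b] 1 k) ∧
    hypergeometricPFQ [a, b, c + d - a - b - 1] [c, d] 1 =
      hypergeometricPFQ [1, c - a, c - b] [c - a - b + 1, c + d - a - b] 1 *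
          (Complex.Gamma c * Complex.Gamma d /
            (Complex.Gamma a * Complex.Gamma b * Complex.Gamma (c + d - a - b))) *
          (1 / (a + b - c)) +
        Complex.Gamma c * Complex.Gamma d * Complex.Gamma (c - a - b) *
            Complex.Gamma (d - a - b) /
          (Complex.Gamma (c - a) * Complex.Gamma (c - b) *
            Complex.Gamma (d - a) * Complex.Gamma (d - b)) := by
  have hterm : ∀ x y z u v : ℂ, hypergeometricTerm [x, y, z] [u, v] 1 =
      fun k => shiftedFactorial x k * shiftedFactorial y k * shiftedFactorial z k /
        (shiftedFactorial 1 k * shiftedFactorial u k * shiftedFactorial v k) := by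
    intro x y z u v
    funext k
    simp [hypergeometricTerm, shiftedFactorial_one, mul_assoc]
  have hcab1 : ∀ n : ℕ, c - a - b + 1 ≠ -(n : ℂ) := by simpa using add_natCast_ne_neg hcab 1
  have hs1 := summable_saalschutz a b hc hd
  have hs2 : Summable fun k : ℕ =>
      shiftedFactorial 1 k * shiftedFactorial (c - a) k * shiftedFactorial (c - b) k /
        (shiftedFactorial 1 k * shiftedFactorial (c - a - b + 1) k *
          shiftedFactorial (c + d - a - b) k) :=
    summable_shiftedFactorial_ratio one_ne_neg_natCast hcab1 hcdab
      (by simp at hre ⊢; linarith)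
  simp only [hypergeometricPFQ, hterm]
  refine ⟨hs1, hs2, ?_⟩
  have hcab0 := ne_zero_of_ne_neg_natCast hcab
  set S : ℂ → ℂ := fun x => ∑' k : ℕ, shiftedFactorial a k * shiftedFactorial b k *
    shiftedFactorial (x + d - a - b - 1) k /
      (shiftedFactorial 1 k * shiftedFactorial x k * shiftedFactorial d k) with hS
  set β : ℂ → ℂ := fun x => -1 / (x - a - b) * (Complex.Gamma x * Complex.Gamma d /
    (Complex.Gamma a * Complex.Gamma b * Complex.Gamma (x + d - a - b))) with hβ
  have hrec : ∀ n : ℕ, S (c + n) =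
      (c + n - a) * (c + n - b) / ((c + n) * (c + n - a - b)) * S (c + (n + 1 : ℕ)) +
        β (c + n) := by
    intro n
    have h := tsum_saalschutz_contiguous a b (add_natCast_ne_neg hc n) hd
      (by
        rw [show c + n - a - b = c - a - b + n by ring]
        exact add_natCast_ne_zero hcab n)
      (by
        rw [show c + n + d - a - b = c + d - a - b + n by ring]
        exact add_natCast_ne_neg hcdab n)
    rw [Nat.cast_succ, ← add_assoc]
    exact h
  have hiter : ∀ N : ℕ, _ = _ := fun N => eq_prod_mul_add_sum_of_recurrence hrec N
  simp only [prod_contiguity_factor, Nat.cast_zero, add_zero] at hiter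
  -- The boundary contributions are the terms of the second series, by `Γ (x + n) = (x)_n Γ x`.
  have hboundary : ∀ n : ℕ, shiftedFactorial (c - a) n * shiftedFactorial (c - b) n /
      (shiftedFactorial c n * shiftedFactorial (c - a - b) n) * β (c + n) =
      shiftedFactorial 1 n * shiftedFactorial (c - a) n * shiftedFactorial (c - b) n /
        (shiftedFactorial 1 n * shiftedFactorial (c - a - b + 1) n *
          shiftedFactorial (c + d - a - b) n) * β c := by
    intro n
    simp only [hβ]
    rw [show c + n - a - b = c - a - b + n by ring,
      show c + n + d - a - b = c + d - a - b + n by ring, Gamma_add_natCast hc,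
      Gamma_add_natCast hcdab, shiftedFactorial_add_one_eq hcab0]
    have := shiftedFactorial_ne_zero one_ne_neg_natCast n
    have := shiftedFactorial_ne_zero hc n
    have := shiftedFactorial_ne_zero hcab n
    have := add_natCast_ne_zero hcab n
    -- `Γ a` and `Γ b` may vanish, so their inverses are kept as atoms.
    simp only [div_eq_mul_inv, mul_inv, inv_inv]
    generalize (Complex.Gamma a)⁻¹ = ga
    generalize (Complex.Gamma b)⁻¹ = gb
    generalize (Complex.Gamma (c + d - a - b))⁻¹ = ge
    generalize (shiftedFactorial (c + d - a - b) n)⁻¹ = se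
    field_simp
  simp only [hboundary] at hiter
  have hlim := ((tendsto_shiftedFactorial_balanced (c - a) (c - b) hc hcab (by ring)).mul
    (tendsto_tsum_saalschutz_add (a := a) (b := b) (c := c) hd hre)).add
    (hs2.hasSum.mul_right (β c)).tendsto_sum_nat
  have hfinal := tendsto_nhds_unique (tendsto_const_nhds.congr hiter) hlim
  rw [tsum_gauss hd hre] at hfinal
  refine hfinal.trans ?_
  simp only [hβ]
  rw [show a + b - c = -(c - a - b) by ring, div_mul_div_comm, add_comm]
  congr 1
  · rw [neg_div, one_div, one_div, inv_neg]
    ring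
  · congr 1 <;> ring
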